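/- Let $n\ge 1$, and let $|\cdot|$ be the Euclidean norm and $\|\cdot\|$ the induced matrix 2-norm. Consider the cascade impulsive delay system with state $(z,\epsilon)$, $\epsilon=(e,p)$, $z,e,p\in\mathbb R^n$, $$\dot z(r)=\Gamma z(r)+\Delta z(r-\tau)+\Delta e(r)+\varphi(z(r)),\quad \dot e(r)=A(r)e(r),\quad \dot p(r)=0\qquad (r\ne\rho_k),$$ $$z(r^+)=z(r),\quad e(r^+)=e(r)+\tfrac14\,\mathrm{diag}(\mathrm{sgn}(-e(r)))\,p(r),\quad p(r^+)=\Lambda p(r)\qquad (r=\rho_k),$$ where $k=0,1,2,\dots$, $\tau\ge 0$ and $0<T_m\le\rho_{k+1}-\rho_k\le T_M$ for all $k$. Values at a jump time are those before the jump, and the initial data are functions on $[\rho_0-2\tau,\rho_0]$, with $z$ continuous and $\epsilon$ bounded there. Assume the following. (i) $\|\Gamma\|\le a$ and $\|\Delta\|\le a$ with $a\ge1$, and there is $Q=Q^T>0$ with $\|Q\|\le q$ and $(\Gamma+\Delta)^TQ+Q(\Gamma+\Delta)\le -I$. (ii) $|\varphi(z)|\le\gamma|z|$ for all $z\in\mathbb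 R^n$. (iii) There are constants $F_i\ge0$ such that, for $r\ge\rho_0$, $A(r)$ is strictly upper triangular with $|A_{ij}(r)|\le F_i$ for $i<j$. The matrix $\Lambda$ is Schur stable (all its eigenvalues lie strictly inside the unit circle) and satisfies, for all $i,j$, $\Lambda_{ij}\ge\frac12\delta_{ij}+F_iT_M\sum_{l>i}\Lambda_{lj}$, where $\delta_{ij}$ is the Kronecker symbol. (For example, $\Lambda$ can be the upper triangular matrix for which equality holds.) If $$\gamma\le\frac1{8q}\qquad\text{and}\qquad \tau\le\frac1{8a^2(8aq+1)^2},$$ then there are positive real numbers $\mu,\delta$, independent of $A$ and of the solution, such that every solution with $|e_i(\rho_0)|\le p_i(\rho_0)/2$ for $i=1,\dots,n$ satisfies, for all $r\ge\rho_0$, $$|(z(r),\epsilon(r))|\le\mu\,\|(z,\epsilon)_{\rho_0}\|\,e^{-\delta(r-\rho_0)},\qquad \|(z,\epsilon)_{\rho_0}\|:=\sup_{-2\tau\le\sigma\le0}|(z,\epsilon)(\rho_0+\sigma)|.$$ -/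

import Mathlib

open Set Filter Topology

/-- `ℝⁿ` with the Euclidean norm. -/
abbrev Vec (n : ℕ) : Type := EuclideanSpace ℝ (Fin n)

/-- The linear map `v ↦ A v` on Euclidean space given by a square real matrix. -/
noncomputable abbrev act {n : ℕ} (A : Matrix (Fin n) (Fin n) ℝ) : Vec n →L[ℝ] Vec n :=
  Matrix.toEuclideanCLM (𝕜 := ℝ) A

/-- The induced matrix 2-norm. -/
noncomputable def inducedNorm {n : ℕ} (A : Matrix (Fin n) (Fin n) ℝ) : ℝ := ‖act A‖

/-- Schur stability: all complex eigenvalues lie strictly inside the unit circle. -/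
def IsSchurStable {n : ℕ} (A : Matrix (Fin n) (Fin n) ℝ) : Prop :=
  ∀ s ∈ spectrum ℂ (A.map (fun x : ℝ => (x : ℂ))), ‖s‖ < 1

/-- `Q = Qᵀ > 0` and `Mᵀ Q + Q M ≤ -I`. -/
def IsLyapunovMatrix {n : ℕ} (M Q : Matrix (Fin n) (Fin n) ℝ) : Prop :=
  Q.PosDef ∧ (-1 - (M.transpose * Q + Q * M)).PosSemidef

/-- The jump map of the quantization error, `e ↦ e + 4⁻¹ diag(sgn(-e)) p`. -/
noncomputable def errorJump {n : ℕ} (e p : Vec n) : Vec n :=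
  WithLp.toLp 2 (fun i => e i + 4⁻¹ * (Real.sign (-(e i)) * p i))

/-- The jump times: consecutive gaps lie in `[Tm, TM]`, where `0 < Tm`. -/
def IsJumpSequence (Tm TM : ℝ) (ρ : ℕ → ℝ) : Prop :=
  0 < Tm ∧ ∀ k, Tm ≤ ρ (k + 1) - ρ k ∧ ρ (k + 1) - ρ k ≤ TM

/-- The coefficient matrix of the error flow is strictly upper triangular and, from time `r₀` on,
the entries of its `i`-th row are bounded by `F i`. -/
def IsErrorCoefficient {n : ℕ} (F : Fin n → ℝ) (r₀ : ℝ) (A : ℝ → Matrix (Fin n) (Fin n) ℝ) :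
    Prop :=
  ∀ r, r₀ ≤ r → ∀ i j, (j ≤ i → A r i j = 0) ∧ (i < j → |A r i j| ≤ F i)

/-- The matrix that updates the size `p` of the quantization region: Schur stable, and entrywise
`Λ i j ≥ (1/2) δ i j + F i * TM * ∑ l > i, Λ l j`. Equality describes the upper triangular matrix
with diagonal entries `1/2` whose row `i` right of the diagonal is `F i * TM` times the sum of the
rows of `Λ` below it. -/
def IsSizeUpdate {n : ℕ} (F : Fin n → ℝ) (TM : ℝ) (Λ : Matrix (Fin n) (Fin n) ℝ) : Prop :=
  IsSchurStable Λ ∧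
    ∀ i j, (if i = j then (1 / 2 : ℝ) else 0) + F i * TM * ∑ l ∈ Finset.Ioi i, Λ l j ≤ Λ i j

/-- The Euclidean norm of the full state `(z, ε) = (z, e, p)`. -/
noncomputable def stateNorm {n : ℕ} (z e p : ℝ → Vec n) (r : ℝ) : ℝ :=
  Real.sqrt (‖z r‖ ^ 2 + ‖e r‖ ^ 2 + ‖p r‖ ^ 2)

/-- The norm `‖(z, ε)_r‖ = sup_{-2τ ≤ σ ≤ 0} |(z, ε)(r + σ)|`. -/
noncomputable def historyNorm {n : ℕ} (τ : ℝ) (z e p : ℝ → Vec n) (r : ℝ) : ℝ :=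
  sSup ((fun σ => stateNorm z e p (r + σ)) '' Icc (-(2 * τ)) 0)

/-- `(z, e, p)` solves, from time `ρ 0` on, the cascade impulsive delay system
`z' = Γ z(r) + Δ z(r - τ) + Δ e(r) + φ(z(r))`, `e' = A(r) e`, `p' = 0` for `r ≠ ρ k`,
`z(r⁺) = z(r)`, `e(r⁺) = e + 4⁻¹ diag(sgn(-e)) p`, `p(r⁺) = Λ p` for `r = ρ k`.
The value at a jump time is the one before the jump, so `e` and `p` are left-continuous there;
`z` is continuous. The initial data are the restrictions to `[ρ 0 - 2τ, ρ 0]`. -/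
structure IsCascadeSolution {n : ℕ} (Γ Δ : Matrix (Fin n) (Fin n) ℝ) (φ : Vec n → Vec n) (τ : ℝ)
    (ρ : ℕ → ℝ) (A : ℝ → Matrix (Fin n) (Fin n) ℝ) (Λ : Matrix (Fin n) (Fin n) ℝ)
    (z e p : ℝ → Vec n) : Prop where
  z_cont : ContinuousOn z (Ici (ρ 0 - 2 * τ))
  history_bdd : BddAbove ((fun σ => stateNorm z e p (ρ 0 + σ)) '' Icc (-(2 * τ)) 0)
  z_flow : ∀ k, ∀ r ∈ Ioo (ρ k) (ρ (k + 1)),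
    HasDerivAt z (act Γ (z r) + act Δ (z (r - τ)) + act Δ (e r) + φ (z r)) r
  e_flow : ∀ k, ∀ r ∈ Ioo (ρ k) (ρ (k + 1)), HasDerivAt e (act (A r) (e r)) r
  p_flow : ∀ k, ∀ r ∈ Ioo (ρ k) (ρ (k + 1)), HasDerivAt p 0 r
  e_left : ∀ k, Tendsto e (𝓝[<] (ρ (k + 1))) (𝓝 (e (ρ (k + 1))))
  p_left : ∀ k, Tendsto p (𝓝[<] (ρ (k + 1))) (𝓝 (p (ρ (k + 1))))
  e_jump : ∀ k, Tendsto e (𝓝[>] (ρ k)) (𝓝 (errorJump (e (ρ k)) (p (ρ k))))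
  p_jump : ∀ k, Tendsto p (𝓝[>] (ρ k)) (𝓝 (act Λ (p (ρ k))))

/-! ### Jump times: growth, and location of a given time between two jumps. -/

section JumpTimes

variable {Tm TM : ℝ} {ρ : ℕ → ℝ}

/-! The cascade is treated from the bottom up. The size `p` is constant between jumps and multiplied
by `Λ` at each jump, so it decays geometrically because `Λ` is Schur stable
(`IsJumpSequence.exists_norm_size_le`). The region `|e i| ≤ p i / 2` is invariant: a jump halves the
bound on each coordinate, and the following flow, which is strictly upper triangular, lets it grow
by no more than the inequality on `Λ` allows (`IsCascadeSolution.abs_error_le`). Hence `e` decays at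
least as fast as the bound on `p`.

For `z`, with input `e`, a Razumikhin argument is used. Let `V = ⟪Q z, z⟫`, weighted by `exp (2 δ (r
- ρ 0))`. If the weighted `V` lies above half of a barrier that was never reached before, then the
recent past of `z` and the input are bounded by multiples of `‖z r‖`. So `z r - z (r - τ)` is of
order `τ ‖z r‖`, and for small `τ`, `γ`, `δ` all perturbations are dominated by the `-‖z‖ ^ 2` of
the delay-free Lyapunov inequality (`IsLyapunovPair.decrease_perturbed`). The weighted `V` decreases
there and cannot reach the barrier (`IsDelayedTrajectory.weighted_lt`). -/

theorem IsJumpSequence.strictMono (h : IsJumpSequence Tm TM ρ) : StrictMono ρ :=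
  strictMono_nat_of_lt_succ fun k => by linarith [h.1, (h.2 k).1]

theorem IsJumpSequence.add_mul_le (h : IsJumpSequence Tm TM ρ) (k : ℕ) :
    ρ 0 + k * Tm ≤ ρ k := by
  induction k with
  | zero => simp
  | succ k ih => push_cast; linarith [(h.2 k).1]

theorem IsJumpSequence.le_add_mul (h : IsJumpSequence Tm TM ρ) (k : ℕ) :
    ρ k ≤ ρ 0 + k * TM := by
  induction k with
  | zero => simp
  | succ k ih => push_cast; linarith [(h.2 k).2]

theorem IsJumpSequence.exists_le (h : IsJumpSequence Tm TM ρ) (r : ℝ) : ∃ k, r ≤ ρ k := by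
  obtain ⟨k, hk⟩ := exists_nat_gt ((r - ρ 0) / Tm)
  refine ⟨k, ?_⟩
  have := h.add_mul_le k
  rw [div_lt_iff₀ h.1] at hk
  linarith

theorem IsJumpSequence.exists_mem_Ioc (h : IsJumpSequence Tm TM ρ) {r : ℝ} (hr : ρ 0 < r) :
    ∃ k, r ∈ Ioc (ρ k) (ρ (k + 1)) := by
  classical
  have hex := h.exists_le r
  have hpos : Nat.find hex ≠ 0 := fun h0 => by
    have := Nat.find_spec hex
    rw [h0] at this
    linarith
  obtain ⟨k, hk⟩ := Nat.exists_eq_succ_of_ne_zero hpos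
  refine ⟨k, not_le.1 (Nat.find_min hex (by omega)), ?_⟩
  have := Nat.find_spec hex
  rwa [hk] at this

end JumpTimes

/-! ### Mean value inequalities across jump times, and a barrier principle. -/

section MeanValue

variable {E : Type*} [NormedAddCommGroup E] [NormedSpace ℝ E]

/-- Mean value inequality with a derivative on the open interval only. -/
theorem norm_image_sub_le_of_norm_hasDerivAt_Ioo {f f' : ℝ → E} {s t C : ℝ} (hst : s ≤ t)
    (hf : ContinuousOn f (Icc s t)) (hd : ∀ r ∈ Ioo s t, HasDerivAt f (f' r) r)
    (hC : ∀ r ∈ Ioo s t, ‖f' r‖ ≤ C) : ‖f t - f s‖ ≤ C * (t - s) := by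
  rcases hst.eq_or_lt with rfl | hlt
  · simp
  have key : ∀ u ∈ Ioo s t, ‖f t - f u‖ ≤ C * (t - u) := fun u hu =>
    norm_image_sub_le_of_norm_deriv_right_le_segment (f' := f')
      (hf.mono (Icc_subset_Icc_left hu.1.le))
      (fun x hx => (hd x ⟨hu.1.trans_le hx.1, hx.2⟩).hasDerivWithinAt)
      (fun x hx => hC x ⟨hu.1.trans_le hx.1, hx.2⟩) t (right_mem_Icc.2 hu.2.le)
  have hlim : Tendsto f (𝓝[Ioo s t] s) (𝓝 (f s)) :=
    (hf s (left_mem_Icc.2 hst)).mono Ioo_subset_Icc_self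
  have : (𝓝[Ioo s t] s).NeBot := by
    rw [← mem_closure_iff_nhdsWithin_neBot, closure_Ioo hlt.ne]
    exact left_mem_Icc.2 hst
  have hid : Tendsto (fun u : ℝ => C * (t - u)) (𝓝[Ioo s t] s) (𝓝 (C * (t - s))) :=
    ((by fun_prop : Continuous fun u : ℝ => C * (t - u)).tendsto s).mono_left nhdsWithin_le_nhds
  exact le_of_tendsto_of_tendsto (hlim.const_sub (f t)).norm hid
    (eventually_mem_nhdsWithin.mono key)

/-- Mean value inequality for a continuous function with a derivative between jump times. -/
theorem IsJumpSequence.norm_image_sub_le {Tm TM : ℝ} {ρ : ℕ → ℝ} (h : IsJumpSequence Tm TM ρ)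
    {f f' : ℝ → E} {s t C : ℝ} (h0 : ρ 0 ≤ s) (hst : s ≤ t) (hf : ContinuousOn f (Icc s t))
    (hd : ∀ k, ∀ r ∈ Ioo (ρ k) (ρ (k + 1)), HasDerivAt f (f' r) r)
    (hC : ∀ k, ∀ r ∈ Ioo (ρ k) (ρ (k + 1)), r ∈ Ioo s t → ‖f' r‖ ≤ C) :
    ‖f t - f s‖ ≤ C * (t - s) := by
  obtain ⟨k, hk⟩ := h.exists_le t
  induction k generalizing t with
  | zero =>
    obtain rfl : s = t := by linarith
    simp
  | succ k ih =>
    rcases le_or_gt t (ρ k) with htk | htk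
    · exact ih hst hf hC htk
    have main : ∀ u, ρ k ≤ u → s ≤ u → u ≤ t → ‖f t - f u‖ ≤ C * (t - u) := fun u hu hsu hut =>
      norm_image_sub_le_of_norm_hasDerivAt_Ioo hut (hf.mono (Icc_subset_Icc_left hsu))
        (fun r hr => hd k r ⟨hu.trans_lt hr.1, hr.2.trans_le hk⟩)
        (fun r hr => hC k r ⟨hu.trans_lt hr.1, hr.2.trans_le hk⟩ ⟨hsu.trans_lt hr.1, hr.2⟩)
    rcases le_or_gt (ρ k) s with hsk | hsk
    · exact main s hsk le_rfl hst
    have h1 := ih hsk.le (hf.mono (Icc_subset_Icc_right htk.le))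
      (fun j r hr hr' => hC j r hr ⟨hr'.1, hr'.2.trans htk⟩) le_rfl
    have h2 := main (ρ k) le_rfl hsk.le htk.le
    calc ‖f t - f s‖ ≤ ‖f t - f (ρ k)‖ + ‖f (ρ k) - f s‖ := norm_sub_le_norm_sub_add_norm_sub _ _ _
      _ ≤ C * (t - s) := by linarith

/-- A continuous function stays below a barrier if, between jump times, it decreases strictly
whenever it is near the barrier and has not crossed it before. -/
theorem IsJumpSequence.lt_barrier {Tm TM : ℝ} {ρ : ℕ → ℝ} (h : IsJumpSequence Tm TM ρ)
    {W W' : ℝ → ℝ} {t₀ B : ℝ} (h0 : ρ 0 ≤ t₀) (hB : 0 < B) (hW : ContinuousOn W (Ici t₀))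
    (hstart : W t₀ < B)
    (hd : ∀ k, ∀ r ∈ Ioo (ρ k) (ρ (k + 1)), HasDerivAt W (W' r) r)
    (hneg : ∀ k, ∀ r ∈ Ioo (ρ k) (ρ (k + 1)), t₀ < r → (∀ s ∈ Icc t₀ r, W s < B) →
      B / 2 < W r → W' r < 0) :
    ∀ r, t₀ ≤ r → W r < B := by
  intro r₁ hr₁
  by_contra! hcon
  let S := Icc t₀ r₁ ∩ W ⁻¹' Ici B
  have hSc : IsClosed S :=
    (hW.mono Icc_subset_Ici_self).preimage_isClosed_of_isClosed isClosed_Icc isClosed_Ici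
  have hSne : S.Nonempty := ⟨r₁, ⟨hr₁, le_rfl⟩, hcon⟩
  have hSbdd : BddBelow S := ⟨t₀, fun x hx => hx.1.1⟩
  -- At the first crossing time only the behaviour on the left matters, so `c` may itself be a jump
  -- time: just before `c` the function strictly decreases from values below `B` to a value at least
  -- `B`, which is absurd.
  set c := sInf S with hc
  have hcS : c ∈ S := hSc.csInf_mem hSne hSbdd
  have hbefore : ∀ s, t₀ ≤ s → s < c → W s < B := fun s hs hsc => by
    by_contra! hle
    exact absurd (csInf_le hSbdd ⟨⟨hs, hsc.le.trans hcS.1.2⟩, hle⟩) (not_le.2 hsc)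
  have hct : t₀ < c := lt_of_le_of_ne hcS.1.1 fun heq => by
    have : B ≤ W c := hcS.2
    rw [← heq] at this
    linarith
  obtain ⟨k, hk⟩ := h.exists_mem_Ioc (h0.trans_lt hct)
  have hcont : ContinuousAt W c := (hW c hct.le).continuousAt (Ici_mem_nhds hct)
  have hev : ∀ᶠ x in 𝓝 c, B / 2 < W x :=
    hcont.eventually_const_lt (lt_of_lt_of_le (by linarith) (show B ≤ W c from hcS.2))
  obtain ⟨l, hl, hlc⟩ := exists_Ioc_subset_of_mem_nhds hev ⟨t₀, hct⟩
  obtain ⟨u, hu, huc⟩ := exists_between (max_lt (max_lt hl hct) hk.1)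
  have hlu : l < u := (le_max_left _ _).trans_lt ((le_max_left _ _).trans_lt hu)
  have htu : t₀ < u := (le_max_right _ _).trans_lt ((le_max_left _ _).trans_lt hu)
  have hku : ρ k < u := (le_max_right _ _).trans_lt hu
  have hanti : StrictAntiOn W (Icc u c) := by
    refine strictAntiOn_of_deriv_neg (convex_Icc _ _)
      (hW.mono fun x hx => htu.le.trans hx.1) fun x hx => ?_
    rw [interior_Icc] at hx
    have hxk : x ∈ Ioo (ρ k) (ρ (k + 1)) := ⟨hku.trans hx.1, hx.2.trans_le hk.2⟩
    rw [(hd k x hxk).deriv]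
    exact hneg k x hxk (htu.trans hx.1) (fun s hs => hbefore s hs.1 (hs.2.trans_lt hx.2))
      (hlc ⟨hlu.trans hx.1, hx.2.le⟩)
  have h1 := hanti (left_mem_Icc.2 huc.le) (right_mem_Icc.2 huc.le) huc
  have h2 := hbefore u htu.le huc
  have h3 : B ≤ W c := hcS.2
  linarith

end MeanValue

/-! ### Lyapunov–Razumikhin analysis of the delay equation. -/

section DelayEquation

variable {E : Type*} [NormedAddCommGroup E] [InnerProductSpace ℝ E]

/-- `⟪P x, x⟫` is a Lyapunov function for `x' = (G + D) x`, with all norm bounds at hand. -/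
structure IsLyapunovPair (G D P : E →L[ℝ] E) (q a : ℝ) : Prop where
  symm : ∀ x y, inner ℝ (P x) y = inner ℝ x (P y)
  nonneg : ∀ x, 0 ≤ inner ℝ (P x) x
  decrease : ∀ x, 2 * inner ℝ (P x) ((G + D) x) ≤ -‖x‖ ^ 2
  norm_P : ‖P‖ ≤ q
  norm_G : ‖G‖ ≤ a
  norm_D : ‖D‖ ≤ a
  one_le : 1 ≤ a

namespace IsLyapunovPair

variable {G D P : E →L[ℝ] E} {q a : ℝ}

theorem norm_P_apply_le (h : IsLyapunovPair G D P q a) (x : E) : ‖P x‖ ≤ q * ‖x‖ :=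
  P.le_of_opNorm_le h.norm_P x

theorem norm_G_apply_le (h : IsLyapunovPair G D P q a) (x : E) : ‖G x‖ ≤ a * ‖x‖ :=
  G.le_of_opNorm_le h.norm_G x

theorem norm_D_apply_le (h : IsLyapunovPair G D P q a) (x : E) : ‖D x‖ ≤ a * ‖x‖ :=
  D.le_of_opNorm_le h.norm_D x

theorem inner_le (h : IsLyapunovPair G D P q a) (x y : E) :
    inner ℝ (P x) y ≤ q * ‖x‖ * ‖y‖ :=
  (real_inner_le_norm _ _).trans (mul_le_mul_of_nonneg_right (h.norm_P_apply_le x) (norm_nonneg y))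

theorem norm_add_apply_le (h : IsLyapunovPair G D P q a) (x : E) :
    ‖(G + D) x‖ ≤ 2 * a * ‖x‖ := by
  have := norm_add_le (G x) (D x)
  have := h.norm_G_apply_le x
  have := h.norm_D_apply_le x
  rw [add_apply]
  linarith

/-- On a unit vector the Lyapunov inequality forces `2 * ‖P‖ * ‖G + D‖ ≥ 1`. This gives `q > 0` and
lets the bounds on `γ` and `τ` be restated in terms of `a`. -/
theorem one_le_four_mul [Nontrivial E] (h : IsLyapunovPair G D P q a) : 1 ≤ 4 * a * q := by
  obtain ⟨x, hx⟩ := exists_norm_eq E zero_le_one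
  have h1 := h.decrease x
  have h2 := h.inner_le x (-((G + D) x))
  have h3 := h.norm_add_apply_le x
  have hq : 0 ≤ q := (norm_nonneg P).trans h.norm_P
  rw [inner_neg_right, norm_neg, hx, mul_one] at h2
  rw [hx] at h1 h3
  nlinarith

theorem q_pos [Nontrivial E] (h : IsLyapunovPair G D P q a) : 0 < q := by
  have h1 := h.one_le_four_mul
  have h2 := h.one_le
  by_contra! hq
  nlinarith

/-- Coercivity with an explicit constant comes from the decrease inequality: the nonnegative form is
tested on `K x + (G + D) x`, whose cross term contributes `-K ‖x‖ ^ 2`. The choice `K = 8 a² q`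
makes the last term `⟪P y, y⟫ ≤ 4 a² q ‖x‖ ^ 2` cost exactly half of that. -/
theorem norm_sq_le [Nontrivial E] (h : IsLyapunovPair G D P q a) (x : E) :
    ‖x‖ ^ 2 ≤ 16 * a ^ 2 * q * inner ℝ (P x) x := by
  have hq := h.q_pos
  have ha : 0 < a := zero_lt_one.trans_le h.one_le
  set y := (G + D) x with hy
  have h1 := h.decrease x
  have h3 := h.norm_add_apply_le x
  have h4 := h.inner_le y y
  have hs : inner ℝ (P y) x = inner ℝ (P x) y := by rw [h.symm, real_inner_comm]
  have h2 := h.nonneg ((8 * a ^ 2 * q) • x + y)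
  simp only [map_add, map_smul, inner_add_left, inner_add_right, real_inner_smul_left,
    real_inner_smul_right, hs] at h2
  have h5 : q * ‖y‖ * ‖y‖ ≤ q * (2 * a * ‖x‖) ^ 2 := by
    rw [mul_assoc, ← sq]
    gcongr
  have hK : 0 < 8 * a ^ 2 * q := by positivity
  have h6 : 0 ≤ (8 * a ^ 2 * q) * (8 * a ^ 2 * q * inner ℝ (P x) x - ‖x‖ ^ 2 / 2) := by
    nlinarith
  have := nonneg_of_mul_nonneg_right h6 hK
  linarith

/-- The weighted Lyapunov function decreases when the delayed state, the past states and the input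
are controlled by the present state. -/
theorem decrease_perturbed [Nontrivial E] (h : IsLyapunovPair G D P q a) {γ τ δ η : ℝ}
    (hγ : γ ≤ 1 / (8 * q)) (hτ0 : 0 ≤ τ) (hτ : τ ≤ 1 / (8 * a ^ 2 * (8 * a * q + 1) ^ 2))
    (hδ : δ ≤ 1 / (16 * q)) {x y u w : E} (hx : x ≠ 0)
    (hxy : ‖x - y‖ ≤ (20 * a ^ 2 * q * ‖x‖ + a * η) * τ) (hu : ‖u‖ ≤ η)
    (hη : η ≤ ‖x‖ / (32 * a * q)) (hw : ‖w‖ ≤ γ * ‖x‖) :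
    2 * inner ℝ (P x) (G x + D y + D u + w) + 2 * δ * inner ℝ (P x) x < 0 := by
  have hq := h.q_pos
  have ha1 := h.one_le
  have ha : 0 < a := zero_lt_one.trans_le ha1
  have hX : 0 < ‖x‖ := norm_pos_iff.2 hx
  set X := ‖x‖ with hXdef
  have hη0 : 0 ≤ η := (norm_nonneg u).trans hu
  -- The delayed state is replaced by the present one, leaving the error `D (x - y)`.
  have e1 : G x + D y + D u + w = (G + D) x + -D (x - y) + D u + w := by
    rw [map_sub, add_apply]; abel
  have hγ' : q * γ ≤ 1 / 8 := by
    rw [le_div_iff₀ (by positivity)] at hγ; linarith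
  have hδ' : q * δ ≤ 1 / 16 := by
    rw [le_div_iff₀ (by positivity)] at hδ; linarith
  have hη' : 32 * (a * q * η) ≤ X := by
    rw [le_div_iff₀ (by positivity)] at hη; linarith
  rw [le_div_iff₀ (by positivity)] at hτ
  have hτ1 : a ^ 2 * τ ≤ 1 / 8 := by
    have : a ^ 2 * τ * 1 ≤ a ^ 2 * τ * (8 * a * q + 1) ^ 2 := by
      gcongr
      nlinarith [mul_pos ha hq]
    linarith
  -- The summand `8 a q` in the delay bound serves here: `512 a⁴ q² τ ≤ 1`, and `20 / 512 = 5 /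
  -- 128`.
  have hτ2 : q * a * (20 * a ^ 2 * q) * τ ≤ 5 / 128 := by
    have h1 : τ * (8 * a ^ 2) * (8 * a * q) ^ 2 ≤ τ * (8 * a ^ 2) * (8 * a * q + 1) ^ 2 := by
      gcongr; linarith
    have h2 : q * a * (20 * a ^ 2 * q) * τ * 1 ≤ q * a * (20 * a ^ 2 * q) * τ * a := by gcongr
    nlinarith
  have h1 := h.decrease x
  have h2 := h.inner_le x (-D (x - y))
  have h3 := h.inner_le x (D u)
  have h4 := h.inner_le x w
  have h5 := h.inner_le x x
  have h6 := h.norm_D_apply_le (x - y)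
  have h7 := h.norm_D_apply_le u
  rw [norm_neg] at h2
  have b2 : q * X * ‖D (x - y)‖ ≤ 5 / 128 * X ^ 2 + X ^ 2 / 256 := by
    calc q * X * ‖D (x - y)‖ ≤ q * X * (a * ((20 * a ^ 2 * q * X + a * η) * τ)) := by
          gcongr; exact h6.trans (by gcongr)
      _ = q * a * (20 * a ^ 2 * q) * τ * X ^ 2 + (a ^ 2 * τ) * (q * η) * X := by ring
      _ ≤ 5 / 128 * X ^ 2 + 1 / 8 * (X / 32) * X := by
          gcongr
          nlinarith [mul_nonneg hq.le hη0]
      _ = _ := by ring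
  have b3 : q * X * ‖D u‖ ≤ X ^ 2 / 32 := by
    calc q * X * ‖D u‖ ≤ q * X * (a * η) := by
          gcongr; exact h7.trans (by gcongr)
      _ = (a * q * η) * X := by ring
      _ ≤ X / 32 * X := by gcongr; linarith
      _ = _ := by ring
  have b4 : q * X * ‖w‖ ≤ X ^ 2 / 8 := by
    calc q * X * ‖w‖ ≤ q * X * (γ * X) := by gcongr
      _ = (q * γ) * X ^ 2 := by ring
      _ ≤ 1 / 8 * X ^ 2 := by gcongr
      _ = _ := by ring
  have b5 : δ * inner ℝ (P x) x ≤ X ^ 2 / 16 := by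
    rcases le_or_gt δ 0 with hd | hd
    · have := mul_nonneg (neg_nonneg.2 hd) (h.nonneg x)
      nlinarith
    · calc δ * inner ℝ (P x) x ≤ δ * (q * X * X) := by gcongr
        _ = (q * δ) * X ^ 2 := by ring
        _ ≤ 1 / 16 * X ^ 2 := by gcongr
        _ = _ := by ring
  -- The four perturbations add up to `67/256 * X ^ 2`; doubled, this is still below the available
  -- `X ^ 2`.
  rw [e1, inner_add_right, inner_add_right, inner_add_right]
  nlinarith [pow_pos hX 2]

theorem hasDerivAt_weighted (h : IsLyapunovPair G D P q a) {z : ℝ → E} {z' : E} {r : ℝ}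
    (hz : HasDerivAt z z' r) (δ r₀ : ℝ) :
    HasDerivAt (fun s => Real.exp (δ * (s - r₀)) ^ 2 * inner ℝ (P (z s)) (z s))
      (Real.exp (δ * (r - r₀)) ^ 2 *
        (2 * inner ℝ (P (z r)) z' + 2 * δ * inner ℝ (P (z r)) (z r))) r := by
  have h1 : HasDerivAt (fun s => P (z s)) (P z') r := P.hasFDerivAt.comp_hasDerivAt r hz
  have h2 := h1.inner ℝ hz
  have h3 : HasDerivAt (fun s => Real.exp (δ * (s - r₀))) (Real.exp (δ * (r - r₀)) * δ) r := by
    simpa using (((hasDerivAt_id r).sub_const r₀).const_mul δ).exp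
  refine ((h3.pow 2).mul h2).congr_deriv ?_
  rw [h.symm z' (z r), real_inner_comm (P (z r)) z']
  simp
  ring

end IsLyapunovPair

/-- Continuous solutions of `z' = G z + D z(· - τ) + D e + φ(z)` off jump times, with history bounded
by `H` and an input that decays like `M H exp (-δ (r - ρ 0))`. -/
structure IsDelayedTrajectory (G D : E →L[ℝ] E) (φ : E → E) (γ τ δ M H : ℝ) (ρ : ℕ → ℝ)
    (z e : ℝ → E) : Prop where
  cont : ContinuousOn z (Ici (ρ 0 - 2 * τ))
  flow : ∀ k, ∀ r ∈ Ioo (ρ k) (ρ (k + 1)),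
    HasDerivAt z (G (z r) + D (z (r - τ)) + D (e r) + φ (z r)) r
  growth : ∀ x, ‖φ x‖ ≤ γ * ‖x‖
  history : ∀ s ∈ Icc (ρ 0 - 2 * τ) (ρ 0), ‖z s‖ ≤ H
  input : ∀ s, ρ 0 ≤ s → ‖e s‖ * Real.exp (δ * (s - ρ 0)) ≤ M * H
  one_le : 1 ≤ M
  history_pos : 0 < H
  rate_pos : 0 < δ
  rate_le_one : δ ≤ 1
  delay_nonneg : 0 ≤ τ

/-! ### A priori bounds and exponential decay for delayed trajectories. -/

namespace IsDelayedTrajectory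

variable {G D P : E →L[ℝ] E} {φ : E → E} {q a γ τ δ M H Tm TM : ℝ} {ρ : ℕ → ℝ} {z e : ℝ → E}

theorem norm_field_le (hP : IsLyapunovPair G D P q a) (hφ : ∀ x, ‖φ x‖ ≤ γ * ‖x‖) (x y u : E) :
    ‖G x + D y + D u + φ x‖ ≤ (a + γ) * ‖x‖ + a * ‖y‖ + a * ‖u‖ := by
  have h1 := norm_add_le (G x + D y + D u) (φ x)
  have h2 := norm_add_le (G x + D y) (D u)
  have h3 := norm_add_le (G x) (D y)
  have h4 := hP.norm_G_apply_le x
  have h5 := hP.norm_D_apply_le y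
  have h6 := hP.norm_D_apply_le u
  have h7 := hφ x
  linarith

theorem norm_input_le (h : IsDelayedTrajectory G D φ γ τ δ M H ρ z e) {s : ℝ} (hs : ρ 0 ≤ s) :
    ‖e s‖ ≤ M * H := by
  refine le_trans ?_ (h.input s hs)
  have : 1 ≤ Real.exp (δ * (s - ρ 0)) :=
    Real.one_le_exp (mul_nonneg h.rate_pos.le (sub_nonneg.2 hs))
  nlinarith [norm_nonneg (e s)]

theorem delay_le (hP : IsLyapunovPair G D P q a) [Nontrivial E]
    (hτ0 : 0 ≤ τ) (hτ : τ ≤ 1 / (8 * a ^ 2 * (8 * a * q + 1) ^ 2)) : a * τ ≤ 1 / 8 := by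
  have hq := hP.q_pos
  have ha1 := hP.one_le
  have ha : 0 < a := zero_lt_one.trans_le ha1
  rw [le_div_iff₀ (by positivity)] at hτ
  have h1 : a * τ * (1 * 1) ≤ a * τ * (a * (8 * a * q + 1) ^ 2) := by
    gcongr
    nlinarith [mul_pos ha hq]
  linarith

theorem gamma_le (hP : IsLyapunovPair G D P q a) [Nontrivial E] (hγ : γ ≤ 1 / (8 * q)) :
    γ ≤ a / 2 := by
  have hq := hP.q_pos
  refine hγ.trans ?_
  rw [div_le_iff₀ (by positivity)]
  linarith [hP.one_le_four_mul]

theorem gamma_nonneg [Nontrivial E] (h : IsDelayedTrajectory G D φ γ τ δ M H ρ z e) : 0 ≤ γ := by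
  obtain ⟨x, hx⟩ := exists_norm_eq E zero_le_one
  have := (norm_nonneg _).trans (h.growth x)
  rwa [hx, mul_one] at this

/-- Before time `ρ 0 + τ` the solution is bounded by a multiple of the history. -/
theorem norm_le_initial [Nontrivial E] (h : IsDelayedTrajectory G D φ γ τ δ M H ρ z e)
    (hP : IsLyapunovPair G D P q a) (hρ : IsJumpSequence Tm TM ρ) (hγ : γ ≤ 1 / (8 * q))
    (hτ : τ ≤ 1 / (8 * a ^ 2 * (8 * a * q + 1) ^ 2)) {s : ℝ}
    (hs : s ∈ Icc (ρ 0 - 2 * τ) (ρ 0 + τ)) : ‖z s‖ ≤ 4 * M * H := by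
  have hτ0 := h.delay_nonneg
  have hM := h.one_le
  have hH := h.history_pos
  have ha : 0 < a := zero_lt_one.trans_le hP.one_le
  have haτ := delay_le hP hτ0 hτ
  have hγ0 := h.gamma_nonneg
  have hγa := gamma_le hP hγ
  rcases le_or_gt s (ρ 0) with hs0 | hs0
  · nlinarith [h.history s ⟨hs.1, hs0⟩]
  -- At the maximum the delayed term still lies in the history, and `a τ ≤ 1/8` lets the maximum be
  -- absorbed on the left; no Gronwall estimate is needed.
  obtain ⟨c, hc, hmax⟩ := (isCompact_Icc (a := ρ 0) (b := ρ 0 + τ)).exists_isMaxOn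
    ⟨ρ 0, by constructor <;> linarith⟩
    (h.cont.mono fun x hx => mem_Ici.2 (by linarith [hx.1])).norm
  refine (hmax (a := s) ⟨hs0.le, hs.2⟩).trans ?_
  set m := ‖z c‖ with hm
  have hm0 : 0 ≤ m := norm_nonneg _
  have hbound : ‖z c - z (ρ 0)‖ ≤ ((a + γ) * m + a * H + a * (M * H)) * (c - ρ 0) := by
    refine hρ.norm_image_sub_le le_rfl hc.1
      (h.cont.mono fun x hx => mem_Ici.2 (by linarith [hx.1])) h.flow fun k r _ hr => ?_
    refine (norm_field_le hP h.growth _ _ _).trans ?_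
    have h1 : ‖z r‖ ≤ m := hmax (a := r) ⟨hr.1.le, by linarith [hr.2, hc.2]⟩
    have h2 : ‖z (r - τ)‖ ≤ H := h.history _ ⟨by linarith [hr.1], by linarith [hr.2, hc.2]⟩
    have h3 : ‖e r‖ ≤ M * H := h.norm_input_le hr.1.le
    gcongr
  have hK : 0 ≤ (a + γ) * m + a * H + a * (M * H) := by positivity
  have hb2 : ((a + γ) * m + a * H + a * (M * H)) * (c - ρ 0) ≤
      ((a + γ) * m + a * H + a * (M * H)) * τ := by
    gcongr; linarith [hc.2]
  have h0 : ‖z (ρ 0)‖ ≤ H := h.history _ ⟨by linarith, le_rfl⟩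
  have htri : m ≤ ‖z c - z (ρ 0)‖ + ‖z (ρ 0)‖ := by
    simpa using norm_add_le (z c - z (ρ 0)) (z (ρ 0))
  have hMH : H ≤ M * H := by nlinarith
  have hγτ : γ * τ ≤ 1 / 16 := by nlinarith
  have e1 : ((a + γ) * m + a * H + a * (M * H)) * τ =
      (a * τ) * (m + H + M * H) + (γ * τ) * m := by ring
  have e2 : (a * τ) * (m + H + M * H) ≤ 1 / 8 * (m + H + M * H) := by gcongr
  have e3 : (γ * τ) * m ≤ 1 / 16 * m := by gcongr
  linarith

/-- The squared weight changes by a factor of at most `exp (1/2) ≤ 1 / (1 - 1/2) = 2`. Applied over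
windows of length at most `2 τ`. -/
theorem exp_le_two_mul {d r s r₀ t : ℝ} (hd : d * (r - s) ≤ t) (ht : t ≤ 1 / 4) :
    Real.exp (d * (r - r₀)) ^ 2 ≤ 2 * Real.exp (d * (s - r₀)) ^ 2 := by
  have h1 : Real.exp (d * (r - r₀)) = Real.exp (d * (r - s)) * Real.exp (d * (s - r₀)) := by
    rw [← Real.exp_add]; ring_nf
  have h2 : Real.exp (d * (r - s)) ^ 2 ≤ 2 := by
    rw [← Real.exp_nat_mul]
    refine (Real.exp_le_exp.2 (show _ ≤ (1 / 2 : ℝ) by push_cast; linarith)).trans ?_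
    refine (Real.exp_bound_div_one_sub_of_interval (by norm_num) (by norm_num)).trans ?_
    norm_num
  rw [h1, mul_pow]
  gcongr

/-- The start at `ρ 0 + τ` ensures that the equation holds on all of `[r - τ, r]` off jump times, so
that `z r - z (r - τ)` can be estimated. The barrier is `2 q (64 a q M H) ^ 2`: above half of it,
`‖z r‖` dominates the input. -/
theorem weighted_lt [Nontrivial E] (h : IsDelayedTrajectory G D φ γ τ δ M H ρ z e)
    (hP : IsLyapunovPair G D P q a) (hρ : IsJumpSequence Tm TM ρ) (hγ : γ ≤ 1 / (8 * q))
    (hτ : τ ≤ 1 / (8 * a ^ 2 * (8 * a * q + 1) ^ 2)) (hδ : δ ≤ 1 / (16 * q)) {r : ℝ}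
    (hr : ρ 0 + τ ≤ r) :
    Real.exp (δ * (r - ρ 0)) ^ 2 * inner ℝ (P (z r)) (z r) <
      8192 * a ^ 2 * q ^ 3 * (M * H) ^ 2 := by
  have hτ0 := h.delay_nonneg
  have hM : 0 < M := zero_lt_one.trans_le h.one_le
  have hH := h.history_pos
  have hq := hP.q_pos
  have ha1 := hP.one_le
  have ha : 0 < a := zero_lt_one.trans_le ha1
  have haq := hP.one_le_four_mul
  have haτ := delay_le hP hτ0 hτ
  have hγ0 := h.gamma_nonneg
  have hγa := gamma_le hP hγ
  have hτ8 : τ ≤ 1 / 8 := by nlinarith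
  have hδτ : δ * (2 * τ) ≤ 1 / 4 := by nlinarith [h.rate_le_one, h.rate_pos]
  set V : ℝ → ℝ := fun s => inner ℝ (P (z s)) (z s) with hV
  set ω : ℝ → ℝ := fun s => Real.exp (δ * (s - ρ 0)) with hω
  have hω0 : ∀ s, 0 < ω s := fun s => Real.exp_pos _
  set B := 8192 * a ^ 2 * q ^ 3 * (M * H) ^ 2 with hBdef
  have hB : 0 < B := by positivity
  have hinit : ∀ s ∈ Icc (ρ 0 - 2 * τ) (ρ 0 + τ), ω s ^ 2 * V s < B := fun s hs => by
    have h1 := h.norm_le_initial hP hρ hγ hτ hs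
    have h2 : V s ≤ q * ‖z s‖ * ‖z s‖ := hP.inner_le _ _
    have h3 : ω s ^ 2 ≤ 2 * ω (ρ 0) ^ 2 :=
      exp_le_two_mul (t := δ * (2 * τ))
        (mul_le_mul_of_nonneg_left (by linarith [hs.2]) h.rate_pos.le) hδτ
    have h4 : ω (ρ 0) = 1 := by simp [hω]
    rw [h4] at h3
    have h5 : V s ≤ q * (4 * M * H) ^ 2 := by
      refine h2.trans ?_
      rw [mul_assoc, ← sq]
      gcongr
    calc ω s ^ 2 * V s ≤ 2 * (q * (4 * M * H) ^ 2) := by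
          have := hP.nonneg (z s)
          exact mul_le_mul (by linarith) h5 this (by norm_num)
      _ = 32 * q * 1 * (M * H) ^ 2 := by ring
      _ < 512 * q * (4 * a * q) ^ 2 * (M * H) ^ 2 := by
          have : 0 < q * (M * H) ^ 2 := by positivity
          have : 1 ≤ (4 * a * q) ^ 2 := one_le_pow₀ haq
          nlinarith
      _ = B := by rw [hBdef]; ring
  refine hρ.lt_barrier (W := fun s => ω s ^ 2 * V s) (t₀ := ρ 0 + τ) (by linarith) hB ?_
    (hinit _ ⟨by linarith, le_rfl⟩) (fun k r hr => hP.hasDerivAt_weighted (h.flow k r hr) δ (ρ 0))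
    ?_ r hr
  · have hz : ContinuousOn z (Ici (ρ 0 + τ)) :=
      h.cont.mono (Ici_subset_Ici.2 (by linarith))
    have : ContinuousOn V (Ici (ρ 0 + τ)) := (P.continuous.comp_continuousOn hz).inner hz
    have h2 : Continuous ω := by fun_prop
    exact (h2.pow 2).continuousOn.mul this
  · intro k r hrk hr hbefore hnear
    have hρk : ρ 0 ≤ ρ k := hρ.strictMono.monotone (Nat.zero_le k)
    have hpast : ∀ s ∈ Icc (ρ 0 - 2 * τ) r, ω s ^ 2 * V s < B := fun s hs => by
      rcases le_total s (ρ 0 + τ) with hle | hle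
      · exact hinit s ⟨hs.1, hle⟩
      · exact hbefore s ⟨hle, hs.2⟩
    have hωr : ∀ s, r - 2 * τ ≤ s → ω r ^ 2 ≤ 2 * ω s ^ 2 := fun s hs =>
      exp_le_two_mul (t := δ * (2 * τ))
        (mul_le_mul_of_nonneg_left (by linarith) h.rate_pos.le) hδτ
    have hVr : V r ≤ q * ‖z r‖ ^ 2 := by
      have := hP.inner_le (z r) (z r)
      rwa [mul_assoc, ← sq] at this
    have hzs : ∀ s ∈ Icc (r - 2 * τ) r, ‖z s‖ ≤ 8 * a * q * ‖z r‖ := fun s hs => by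
      have h1 := hP.norm_sq_le (z s)
      have h2 := hpast s ⟨by linarith [hs.1], hs.2⟩
      have h3 := hωr s hs.1
      have hVs : 0 ≤ V s := hP.nonneg (z s)
      -- Razumikhin condition: one factor 2 comes from `B < 2 * (ω r ^ 2 * V r)`, the other from the
      -- change of the weight.
      have h4 : V s ≤ 4 * V r := by
        have : ω r ^ 2 * V s ≤ ω r ^ 2 * (4 * V r) := by nlinarith
        exact le_of_mul_le_mul_left this (pow_pos (hω0 r) 2)
      refine (abs_le_of_sq_le_sq' ?_ (by positivity)).2
      calc ‖z s‖ ^ 2 ≤ 16 * a ^ 2 * q * V s := h1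
        _ ≤ 16 * a ^ 2 * q * (4 * (q * ‖z r‖ ^ 2)) := by gcongr; linarith
        _ = (8 * a * q * ‖z r‖) ^ 2 := by ring
    set η := 2 * (M * H) / ω r with hη
    have hes : ∀ s ∈ Icc (r - τ) r, ‖e s‖ ≤ η := fun s hs => by
      have h1 := h.input s (by linarith [hs.1])
      have h3 := hωr s (by linarith [hs.1])
      have h4 : ω r ≤ 2 * ω s := by
        refine abs_le_of_sq_le_sq' (by nlinarith [pow_pos (hω0 s) 2]) (by linarith [hω0 s]) |>.2
      rw [hη, le_div_iff₀ (hω0 r)]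
      calc ‖e s‖ * ω r ≤ ‖e s‖ * (2 * ω s) := by gcongr
        _ ≤ _ := by simp only [hω]; linarith
    have hηr : η ≤ ‖z r‖ / (32 * a * q) := by
      rw [hη, div_le_div_iff₀ (hω0 r) (by positivity)]
      refine (abs_le_of_sq_le_sq' ?_ (by have := hω0 r; positivity)).2
      have h1 : B ≤ 2 * ω r ^ 2 * (q * ‖z r‖ ^ 2) := by
        have : ω r ^ 2 * V r ≤ ω r ^ 2 * (q * ‖z r‖ ^ 2) := by gcongr
        linarith
      have h2 : (2 * q) * (2 * (M * H) * (32 * a * q)) ^ 2 ≤ (2 * q) * (‖z r‖ * ω r) ^ 2 := by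
        rw [hBdef] at h1
        linarith
      exact le_of_mul_le_mul_left h2 (by positivity)
    have hzr : z r ≠ 0 := fun h0 => by
      have : V r = 0 := by simp [hV, h0]
      rw [this] at hnear
      linarith
    have hη0 : 0 ≤ η := (norm_nonneg _).trans (hes r ⟨by linarith, le_rfl⟩)
    have hdelay : ‖z r - z (r - τ)‖ ≤ (20 * a ^ 2 * q * ‖z r‖ + a * η) * (r - (r - τ)) := by
      refine hρ.norm_image_sub_le (by linarith) (by linarith)
        (h.cont.mono fun x hx => mem_Ici.2 (by linarith [hx.1])) h.flow fun j s _ hs => ?_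
      refine (norm_field_le hP h.growth _ _ _).trans ?_
      have h1 := hzs s ⟨by linarith [hs.1], hs.2.le⟩
      have h2 := hzs (s - τ) ⟨by linarith [hs.1], by linarith [hs.2]⟩
      have h3 := hes s ⟨hs.1.le, hs.2.le⟩
      calc (a + γ) * ‖z s‖ + a * ‖z (s - τ)‖ + a * ‖e s‖
          ≤ (a + a / 2) * (8 * a * q * ‖z r‖) + a * (8 * a * q * ‖z r‖) + a * η := by gcongr
        _ = _ := by ring
    rw [sub_sub_cancel] at hdelay
    exact mul_neg_of_pos_of_neg (pow_pos (hω0 r) 2)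
      (hP.decrease_perturbed hγ hτ0 hτ hδ hzr hdelay (hes r ⟨by linarith, le_rfl⟩) hηr
        (h.growth _))

theorem norm_le_exp [Nontrivial E] (h : IsDelayedTrajectory G D φ γ τ δ M H ρ z e)
    (hP : IsLyapunovPair G D P q a) (hρ : IsJumpSequence Tm TM ρ) (hγ : γ ≤ 1 / (8 * q))
    (hτ : τ ≤ 1 / (8 * a ^ 2 * (8 * a * q + 1) ^ 2)) (hδ : δ ≤ 1 / (16 * q)) {r : ℝ}
    (hr : ρ 0 ≤ r) :
    ‖z r‖ * Real.exp (δ * (r - ρ 0)) ≤ 363 * (a * q) ^ 2 * (M * H) := by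
  have hτ0 := h.delay_nonneg
  have hM : 0 < M := zero_lt_one.trans_le h.one_le
  have hH := h.history_pos
  have hq := hP.q_pos
  have ha : 0 < a := zero_lt_one.trans_le hP.one_le
  have haq := hP.one_le_four_mul
  have haτ := delay_le hP hτ0 hτ
  have hexp := Real.exp_pos (δ * (r - ρ 0))
  refine (abs_le_of_sq_le_sq' ?_ (by positivity)).2
  rcases le_or_gt r (ρ 0 + τ) with hrτ | hrτ
  · have h1 := h.norm_le_initial hP hρ hγ hτ (s := r) ⟨by linarith, hrτ⟩
    have hτ8 : τ ≤ 1 / 8 := by nlinarith [hP.one_le]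
    have h3 : Real.exp (δ * (r - ρ 0)) ^ 2 ≤ 2 * Real.exp (δ * (ρ 0 - ρ 0)) ^ 2 :=
      exp_le_two_mul (t := 1 / 4)
        (by nlinarith [h.rate_pos, h.rate_le_one]) le_rfl
    rw [sub_self, mul_zero, Real.exp_zero] at h3
    have h16 : 1 ≤ 16 * (a * q) ^ 2 := by nlinarith
    calc (‖z r‖ * Real.exp (δ * (r - ρ 0))) ^ 2
        = ‖z r‖ ^ 2 * Real.exp (δ * (r - ρ 0)) ^ 2 := by ring
      _ ≤ (4 * M * H) ^ 2 * (2 * 1 ^ 2) := by gcongr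
      _ ≤ (8 * (M * H)) ^ 2 := by nlinarith [sq_nonneg (M * H)]
      _ ≤ (363 * (a * q) ^ 2 * (M * H)) ^ 2 := by
          gcongr; linarith
  · have h1 := h.weighted_lt hP hρ hγ hτ hδ hrτ.le
    have h2 := hP.norm_sq_le (z r)
    have h3 : 0 ≤ (a ^ 2 * q ^ 2 * (M * H)) ^ 2 := sq_nonneg _
    calc (‖z r‖ * Real.exp (δ * (r - ρ 0))) ^ 2
        = ‖z r‖ ^ 2 * Real.exp (δ * (r - ρ 0)) ^ 2 := by ring
      _ ≤ 16 * a ^ 2 * q * inner ℝ (P (z r)) (z r) * Real.exp (δ * (r - ρ 0)) ^ 2 := by gcongr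
      _ = 16 * a ^ 2 * q * (Real.exp (δ * (r - ρ 0)) ^ 2 * inner ℝ (P (z r)) (z r)) := by ring
      _ ≤ 16 * a ^ 2 * q * (8192 * a ^ 2 * q ^ 3 * (M * H) ^ 2) := by gcongr
      _ = 131072 * (a ^ 2 * q ^ 2 * (M * H)) ^ 2 := by ring
      -- `131072 = 16 * 8192` is rounded up to `363 ^ 2`.
      _ ≤ 131769 * (a ^ 2 * q ^ 2 * (M * H)) ^ 2 := by gcongr; norm_num
      _ = _ := by ring

end IsDelayedTrajectory

end DelayEquation

/-! ### Geometric decay of matrix powers, by Gelfand's formula over `ℂ`. -/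

section SchurPowers

open scoped Matrix.Norms.L2Operator in
/-- The powers of a Schur stable matrix decay geometrically. -/
theorem IsSchurStable.exists_norm_pow_le {n : ℕ} [NeZero n] {A : Matrix (Fin n) (Fin n) ℝ}
    (h : IsSchurStable A) :
    ∃ C l : ℝ, 1 ≤ C ∧ 0 < l ∧ l < 1 ∧ ∀ k v, ‖act (A ^ k) v‖ ≤ C * l ^ k * ‖v‖ := by
  have : CompleteSpace (Matrix (Fin n) (Fin n) ℂ) := FiniteDimensional.complete ℂ _
  set B : Matrix (Fin n) (Fin n) ℂ := A.map (fun x : ℝ => (x : ℂ)) with hB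
  have hrad : spectralRadius ℂ B < (1 : NNReal) :=
    spectrum.spectralRadius_lt_of_forall_lt B fun s hs => by
      simpa [← NNReal.coe_lt_coe] using h s hs
  obtain ⟨l, hl, hl1⟩ := ENNReal.lt_iff_exists_nnreal_btwn.1 hrad
  have hl1' : l < 1 := by exact_mod_cast hl1
  have hl0 : 0 < l := by
    rcases eq_or_ne l 0 with rfl | h0
    · simp at hl
    · exact pos_iff_ne_zero.2 h0
  have hev : ∀ᶠ k : ℕ in atTop, ‖B ^ k‖₊ ≤ l ^ k := by
    filter_upwards [(spectrum.pow_nnnorm_pow_one_div_tendsto_nhds_spectralRadius B).eventually_lt_const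
      hl, eventually_gt_atTop 0] with k hk hk0
    have hk' := ENNReal.rpow_le_rpow hk.le (Nat.cast_nonneg (α := ℝ) k)
    rw [← ENNReal.rpow_mul, one_div, inv_mul_cancel₀ (by positivity), ENNReal.rpow_one,
      ENNReal.rpow_natCast] at hk'
    exact_mod_cast hk'
  obtain ⟨K, hK⟩ := eventually_atTop.1 hev
  have hlR : (0 : ℝ) < l := by exact_mod_cast hl0
  set S := ∑ k ∈ Finset.range K, ‖B ^ k‖ / (l : ℝ) ^ k with hS
  have hS0 : 0 ≤ S := Finset.sum_nonneg fun k _ => by positivity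
  -- Gelfand's formula controls all large powers; `S` absorbs the finitely many others.
  refine ⟨1 + S, l, by linarith, hlR, by exact_mod_cast hl1', fun k v => ?_⟩
  have hpow : ‖B ^ k‖ ≤ (1 + S) * (l : ℝ) ^ k := by
    have hlk : 0 < (l : ℝ) ^ k := by positivity
    rcases lt_or_ge k K with hk | hk
    · have h1 : ‖B ^ k‖ / (l : ℝ) ^ k ≤ S :=
        Finset.single_le_sum (f := fun k => ‖B ^ k‖ / (l : ℝ) ^ k)
          (fun _ _ => by positivity) (Finset.mem_range.2 hk)
      rw [div_le_iff₀ hlk] at h1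
      linarith
    · have h1 : ‖B ^ k‖ ≤ (l : ℝ) ^ k := by exact_mod_cast hK k hk
      nlinarith
  set w : EuclideanSpace ℂ (Fin n) := WithLp.toLp 2 fun i => (v i : ℂ) with hw
  have hwn : ‖w‖ = ‖v‖ := by simp [EuclideanSpace.norm_eq, hw]
  have hBk : B ^ k = (A ^ k).map (fun x : ℝ => (x : ℂ)) :=
    (Matrix.map_pow (f := Complex.ofRealHom) A k).symm
  have hact : ‖act (A ^ k) v‖ = ‖Matrix.toEuclideanCLM (𝕜 := ℂ) (B ^ k) w‖ := by
    rw [EuclideanSpace.norm_eq, EuclideanSpace.norm_eq]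
    congr 1
    refine Finset.sum_congr rfl fun i _ => ?_
    congr 1
    rw [Matrix.ofLp_toEuclideanCLM, Matrix.ofLp_toEuclideanCLM, hBk, ← Complex.norm_real]
    simp [Matrix.mulVec, dotProduct, hw]
  rw [hact, ← hwn]
  exact (ContinuousLinearMap.le_opNorm _ _).trans
    (mul_le_mul_of_nonneg_right hpow (norm_nonneg _))

end SchurPowers

/-! ### The quantization region under one jump and one flow interval. -/

section Quantization

variable {n : ℕ} {F : Fin n → ℝ} {Tm TM : ℝ} {Λ : Matrix (Fin n) (Fin n) ℝ}

theorem act_apply (A : Matrix (Fin n) (Fin n) ℝ) (v : Vec n) (i : Fin n) :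
    act A v i = ∑ j, A i j * v j := by
  rw [Matrix.ofLp_toEuclideanCLM]; rfl

theorem act_pow_succ (A : Matrix (Fin n) (Fin n) ℝ) (k : ℕ) (v : Vec n) :
    act (A ^ (k + 1)) v = act A (act (A ^ k) v) := by
  rw [pow_succ', act, map_mul]; rfl

theorem HasDerivAt.euclidean_apply {f : ℝ → Vec n} {f' : Vec n} {r : ℝ} (h : HasDerivAt f f' r)
    (i : Fin n) : HasDerivAt (fun s => f s i) (f' i) r :=
  (EuclideanSpace.proj (𝕜 := ℝ) i).hasFDerivAt.comp_hasDerivAt r h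

theorem EuclideanSpace.norm_le_norm_of_forall_abs_le {v w : Vec n} (h : ∀ i, |v i| ≤ |w i|) :
    ‖v‖ ≤ ‖w‖ := by
  rw [EuclideanSpace.norm_eq, EuclideanSpace.norm_eq]
  refine Real.sqrt_le_sqrt (Finset.sum_le_sum fun i _ => ?_)
  simpa [sq_abs] using pow_le_pow_left₀ (abs_nonneg _) (h i) 2

/-- Mean value inequality started from a right limit. -/
theorem norm_sub_le_of_tendsto_nhdsGT {E : Type*} [NormedAddCommGroup E] [NormedSpace ℝ E]
    {f f' : ℝ → E} {f₀ : E} {s t C : ℝ} (hd : ∀ r ∈ Ioo s t, HasDerivAt f (f' r) r)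
    (hC : ∀ r ∈ Ioo s t, ‖f' r‖ ≤ C) (h0 : Tendsto f (𝓝[>] s) (𝓝 f₀)) {r : ℝ}
    (hr : r ∈ Ioo s t) : ‖f r - f₀‖ ≤ C * (r - s) := by
  have hid : Tendsto (fun u : ℝ => C * (r - u)) (𝓝[>] s) (𝓝 (C * (r - s))) :=
    ((by fun_prop : Continuous fun u : ℝ => C * (r - u)).tendsto s).mono_left nhdsWithin_le_nhds
  refine le_of_tendsto_of_tendsto (h0.const_sub (f r)).norm hid ?_
  filter_upwards [Ioo_mem_nhdsGT hr.1] with u hu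
  have hsub : ∀ x ∈ Icc u r, x ∈ Ioo s t := fun x hx =>
    ⟨hu.1.trans_le hx.1, hx.2.trans_lt hr.2⟩
  exact norm_image_sub_le_of_norm_hasDerivAt_Ioo hu.2.le
    (fun x hx => (hd x (hsub x hx)).continuousAt.continuousWithinAt)
    (fun x hx => hd x (hsub x (Ioo_subset_Icc_self hx)))
    (fun x hx => hC x (hsub x (Ioo_subset_Icc_self hx)))

/-- Induction from the last row upwards: each row is bounded below by nonnegative multiples of the
rows beneath it. -/
theorem IsSizeUpdate.nonneg (h : IsSizeUpdate F TM Λ) (hF : ∀ i, 0 ≤ F i) (hT : 0 ≤ TM)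
    (i j : Fin n) : 0 ≤ Λ i j := by
  induction i using WellFoundedGT.induction with
  | ind i ih =>
    refine le_trans (add_nonneg ?_ ?_) (h.2 i j)
    · split_ifs <;> norm_num
    · exact mul_nonneg (mul_nonneg (hF i) hT)
        (Finset.sum_nonneg fun l hl => ih l (Finset.mem_Ioi.1 hl))

theorem IsSizeUpdate.act_nonneg (h : IsSizeUpdate F TM Λ) (hF : ∀ i, 0 ≤ F i) (hT : 0 ≤ TM)
    {v : Vec n} (hv : ∀ i, 0 ≤ v i) (i : Fin n) : 0 ≤ act Λ v i := by
  rw [act_apply]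
  exact Finset.sum_nonneg fun j _ => mul_nonneg (h.nonneg hF hT i j) (hv j)

theorem IsSizeUpdate.add_sum_le (h : IsSizeUpdate F TM Λ) {v : Vec n} (hv : ∀ i, 0 ≤ v i)
    (i : Fin n) : v i / 2 + F i * TM * ∑ l ∈ Finset.Ioi i, act Λ v l ≤ act Λ v i := by
  have h1 : ∑ j, ((if i = j then (1 / 2 : ℝ) else 0) + F i * TM * ∑ l ∈ Finset.Ioi i, Λ l j) * v j ≤
      ∑ j, Λ i j * v j :=
    Finset.sum_le_sum fun j _ => mul_le_mul_of_nonneg_right (h.2 i j) (hv j)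
  simp only [act_apply]
  refine le_of_eq_of_le ?_ h1
  simp only [add_mul, Finset.sum_add_distrib, ite_mul, zero_mul, Finset.sum_ite_eq,
    Finset.mem_univ, if_true]
  congr 1
  · ring
  · rw [Finset.sum_comm, Finset.mul_sum]
    refine Finset.sum_congr rfl fun j _ => ?_
    rw [← Finset.sum_mul]
    ring

/-- The jump shifts a nonzero coordinate by `p i / 4` towards zero, recentring `[0, p i / 2]` or its
mirror image at the origin. -/
theorem abs_errorJump_le {e p : Vec n} {i : Fin n} (h : |e i| ≤ p i / 2) :
    |errorJump e p i| ≤ p i / 4 := by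
  change |e i + 4⁻¹ * (Real.sign (-(e i)) * p i)| ≤ p i / 4
  obtain ⟨h1, h2⟩ := abs_le.1 h
  rw [abs_le]
  rcases lt_trichotomy (e i) 0 with hi | hi | hi
  · rw [Real.sign_of_pos (by linarith)]; constructor <;> linarith
  · rw [hi, neg_zero, Real.sign_zero]; constructor <;> linarith
  · rw [Real.sign_of_neg (by linarith)]; constructor <;> linarith

/-- Between two jumps, the error stays in the region with the next size. -/
theorem IsSizeUpdate.abs_flow_le (h : IsSizeUpdate F TM Λ) (hF : ∀ i, 0 ≤ F i) (hT : 0 ≤ TM)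
    {s t r₀ : ℝ} {A : ℝ → Matrix (Fin n) (Fin n) ℝ} (hA : IsErrorCoefficient F r₀ A)
    (hs : r₀ ≤ s) (hst : t - s ≤ TM) {e : ℝ → Vec n} {e₀ v : Vec n}
    (hd : ∀ r ∈ Ioo s t, HasDerivAt e (act (A r) (e r)) r) (h0 : Tendsto e (𝓝[>] s) (𝓝 e₀))
    (hv : ∀ i, 0 ≤ v i) (he : ∀ i, |e₀ i| ≤ v i / 4) (i : Fin n) :
    ∀ r ∈ Ioo s t, |e r i| ≤ act Λ v i / 2 := by
  -- Downward induction: the derivative of `e i` involves only coordinates `l > i`, already bounded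
  -- by `act Λ v l / 2`. Hence `|e i| ≤ v i / 4 + F i * TM * S / 2`, half the left side of
  -- `add_sum_le`.
  induction i using WellFoundedGT.induction with
  | ind i ih =>
    intro r hr
    set S := ∑ l ∈ Finset.Ioi i, act Λ v l with hS
    have hS0 : 0 ≤ S := Finset.sum_nonneg fun l _ => h.act_nonneg hF hT hv l
    have hC : ∀ x ∈ Ioo s t, ‖act (A x) (e x) i‖ ≤ F i * (S / 2) := fun x hx => by
      have hAx := hA x (hs.trans hx.1.le) i
      rw [act_apply, ← Finset.sum_subset (Finset.subset_univ (Finset.Ioi i)) fun j _ hj => by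
        rw [(hAx j).1 (not_lt.1 fun hlt => hj (Finset.mem_Ioi.2 hlt)), zero_mul]]
      refine (norm_sum_le _ _).trans ?_
      rw [hS, Finset.sum_div, Finset.mul_sum]
      refine Finset.sum_le_sum fun j hj => ?_
      rw [norm_mul]
      exact mul_le_mul ((hAx j).2 (Finset.mem_Ioi.1 hj)) (ih j (Finset.mem_Ioi.1 hj) x hx)
        (norm_nonneg _) (hF i)
    have hlim : Tendsto (fun x => e x i) (𝓝[>] s) (𝓝 (e₀ i)) :=
      ((EuclideanSpace.proj (𝕜 := ℝ) i).continuous.tendsto e₀).comp h0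
    have h1 := norm_sub_le_of_tendsto_nhdsGT (fun x hx => (hd x hx).euclidean_apply i) hC hlim hr
    have h2 : F i * (S / 2) * (r - s) ≤ F i * (S / 2) * TM :=
      mul_le_mul_of_nonneg_left (by linarith [hr.2]) (mul_nonneg (hF i) (by linarith))
    have h3 := h.add_sum_le hv i
    have h4 := he i
    have h5 : |e r i| ≤ |e r i - e₀ i| + |e₀ i| := by
      simpa using abs_add_le (e r i - e₀ i) (e₀ i)
    rw [Real.norm_eq_abs] at h1
    linarith

end Quantization

/-! ### Evolution of the size and invariance of the quantization region. -/

namespace IsCascadeSolution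

variable {n : ℕ} {Γ Δ Λ : Matrix (Fin n) (Fin n) ℝ} {φ : Vec n → Vec n} {τ Tm TM : ℝ}
  {ρ : ℕ → ℝ} {F : Fin n → ℝ} {A : ℝ → Matrix (Fin n) (Fin n) ℝ} {z e p : ℝ → Vec n}

theorem p_eq (h : IsCascadeSolution Γ Δ φ τ ρ A Λ z e p) (hρ : IsJumpSequence Tm TM ρ) {k : ℕ}
    {r : ℝ} (hr : r ∈ Ioc (ρ k) (ρ (k + 1))) : p r = act Λ (p (ρ k)) := by
  have hopen : ∀ x ∈ Ioo (ρ k) (ρ (k + 1)), p x = act Λ (p (ρ k)) := fun x hx => by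
    have := norm_sub_le_of_tendsto_nhdsGT (C := 0) (h.p_flow k) (by simp) (h.p_jump k) hx
    rw [zero_mul] at this
    exact sub_eq_zero.1 (norm_le_zero_iff.1 this)
  rcases hr.2.eq_or_lt with heq | hlt
  · have hkk : ρ k < ρ (k + 1) := hρ.strictMono (Nat.lt_succ_self k)
    rw [heq]
    refine tendsto_nhds_unique (h.p_left k) (tendsto_const_nhds.congr' ?_)
    filter_upwards [Ioo_mem_nhdsLT hkk] with x hx using (hopen x hx).symm
  · exact hopen r ⟨hr.1, hlt⟩

theorem p_jump_time (h : IsCascadeSolution Γ Δ φ τ ρ A Λ z e p) (hρ : IsJumpSequence Tm TM ρ)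
    (k : ℕ) : p (ρ k) = act (Λ ^ k) (p (ρ 0)) := by
  induction k with
  | zero => simp [act]
  | succ k ih =>
    rw [h.p_eq hρ ⟨hρ.strictMono (Nat.lt_succ_self k), le_rfl⟩, ih, act_pow_succ]

theorem abs_error_le_of_jump (h : IsCascadeSolution Γ Δ φ τ ρ A Λ z e p)
    (hρ : IsJumpSequence Tm TM ρ) (hF : ∀ i, 0 ≤ F i) (hΛ : IsSizeUpdate F TM Λ)
    (hA : IsErrorCoefficient F (ρ 0) A) {k : ℕ} (hk : ∀ i, |e (ρ k) i| ≤ p (ρ k) i / 2) {r : ℝ}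
    (hr : r ∈ Ioc (ρ k) (ρ (k + 1))) (i : Fin n) : |e r i| ≤ p r i / 2 := by
  have hT : 0 ≤ TM := by linarith [hρ.1, (hρ.2 0).1, (hρ.2 0).2]
  rw [h.p_eq hρ hr]
  have hopen := hΛ.abs_flow_le hF hT hA (hρ.strictMono.monotone (Nat.zero_le k)) (hρ.2 k).2
    (h.e_flow k) (h.e_jump k) (fun i => by linarith [abs_nonneg (e (ρ k) i), hk i])
    (fun i => abs_errorJump_le (hk i)) i
  rcases hr.2.eq_or_lt with heq | hlt
  · have hkk : ρ k < ρ (k + 1) := hρ.strictMono (Nat.lt_succ_self k)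
    have hlim : Tendsto (fun x => |e x i|) (𝓝[<] (ρ (k + 1))) (𝓝 |e (ρ (k + 1)) i|) :=
      (((EuclideanSpace.proj (𝕜 := ℝ) i).continuous.tendsto _).comp (h.e_left k)).abs
    rw [heq]
    refine le_of_tendsto hlim ?_
    filter_upwards [Ioo_mem_nhdsLT hkk] with x hx using hopen x hx
  · exact hopen r ⟨hr.1, hlt⟩

/-- The error never leaves the quantization region. -/
theorem abs_error_le (h : IsCascadeSolution Γ Δ φ τ ρ A Λ z e p)
    (hρ : IsJumpSequence Tm TM ρ) (hF : ∀ i, 0 ≤ F i) (hΛ : IsSizeUpdate F TM Λ)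
    (hA : IsErrorCoefficient F (ρ 0) A) (h0 : ∀ i, |e (ρ 0) i| ≤ p (ρ 0) i / 2) {r : ℝ}
    (hr : ρ 0 ≤ r) (i : Fin n) : |e r i| ≤ p r i / 2 := by
  have hjump : ∀ k i, |e (ρ k) i| ≤ p (ρ k) i / 2 := fun k => by
    induction k with
    | zero => exact h0
    | succ k ih =>
      exact h.abs_error_le_of_jump hρ hF hΛ hA ih ⟨hρ.strictMono (Nat.lt_succ_self k), le_rfl⟩
  rcases hr.eq_or_lt with rfl | hlt
  · exact h0 i
  · obtain ⟨k, hk⟩ := hρ.exists_mem_Ioc hlt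
    exact h.abs_error_le_of_jump hρ hF hΛ hA (hjump k) hk i

theorem norm_error_le (h : IsCascadeSolution Γ Δ φ τ ρ A Λ z e p)
    (hρ : IsJumpSequence Tm TM ρ) (hF : ∀ i, 0 ≤ F i) (hΛ : IsSizeUpdate F TM Λ)
    (hA : IsErrorCoefficient F (ρ 0) A) (h0 : ∀ i, |e (ρ 0) i| ≤ p (ρ 0) i / 2) {r : ℝ}
    (hr : ρ 0 ≤ r) : ‖e r‖ ≤ ‖p r‖ :=
  EuclideanSpace.norm_le_norm_of_forall_abs_le fun i => by
    have := h.abs_error_le hρ hF hΛ hA h0 hr i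
    have := abs_nonneg (e r i)
    exact le_trans (by linarith) (le_abs_self (p r i))

end IsCascadeSolution

/-- The size of the quantization region decays exponentially, at a rate given by the data. -/
theorem IsJumpSequence.exists_norm_size_le {n : ℕ} [NeZero n] {Tm TM : ℝ} {ρ : ℕ → ℝ}
    (hρ : IsJumpSequence Tm TM ρ) {Λ : Matrix (Fin n) (Fin n) ℝ} (hΛ : IsSchurStable Λ) :
    ∃ M δ : ℝ, 1 ≤ M ∧ 0 < δ ∧ ∀ (Γ Δ : Matrix (Fin n) (Fin n) ℝ) (φ : Vec n → Vec n) (τ : ℝ)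
      (A : ℝ → Matrix (Fin n) (Fin n) ℝ) (z e p : ℝ → Vec n),
      IsCascadeSolution Γ Δ φ τ ρ A Λ z e p → ∀ r, ρ 0 ≤ r →
        ‖p r‖ * Real.exp (δ * (r - ρ 0)) ≤ M * ‖p (ρ 0)‖ := by
  obtain ⟨C, l, hC, hl0, hl1, hpow⟩ := hΛ.exists_norm_pow_le
  have hT : 0 < TM := by linarith [hρ.1, (hρ.2 0).1, (hρ.2 0).2]
  have hlog : Real.log l < 0 := Real.log_neg hl0 hl1
  -- On `(ρ k, ρ (k + 1)]` the size has been updated `k + 1` times, the jump at `ρ 0` included, and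
  -- `r - ρ 0 ≤ (k + 1) * TM`; hence this rate.
  refine ⟨C, -Real.log l / TM, hC, div_pos (neg_pos.2 hlog) hT,
    fun Γ Δ φ τ A z e p h r hr => ?_⟩
  rcases hr.eq_or_lt with rfl | hlt
  · simpa using mul_le_mul_of_nonneg_right hC (norm_nonneg (p (ρ 0)))
  obtain ⟨k, hk⟩ := hρ.exists_mem_Ioc hlt
  have hexp : Real.exp (-Real.log l / TM * (r - ρ 0)) ≤ (l ^ (k + 1))⁻¹ := by
    have h1 : -Real.log l / TM * (r - ρ 0) ≤ -(((k + 1 : ℕ) : ℝ) * Real.log l) := by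
      have h2 := hk.2.trans (hρ.le_add_mul (k + 1))
      rw [div_mul_eq_mul_div, div_le_iff₀ hT]
      nlinarith
    refine (Real.exp_le_exp.2 h1).trans_eq ?_
    rw [Real.exp_neg, Real.exp_nat_mul, Real.exp_log hl0]
  rw [h.p_eq hρ hk, h.p_jump_time hρ, ← act_pow_succ]
  have hlk : 0 < l ^ (k + 1) := by positivity
  calc _ ≤ C * l ^ (k + 1) * ‖p (ρ 0)‖ * (l ^ (k + 1))⁻¹ :=
        mul_le_mul (hpow _ _) hexp (Real.exp_pos _).le (by positivity)
    _ = C * ‖p (ρ 0)‖ := by field_simp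

/-! ### Comparison of the state norm with its components and with the history. -/

section StateNorm

variable {n : ℕ} {z e p : ℝ → Vec n} {r : ℝ}

theorem stateNorm_nonneg : 0 ≤ stateNorm z e p r := Real.sqrt_nonneg _

theorem stateNorm_le : stateNorm z e p r ≤ ‖z r‖ + ‖e r‖ + ‖p r‖ := by
  have hz := norm_nonneg (z r)
  have he := norm_nonneg (e r)
  have hp := norm_nonneg (p r)
  exact Real.sqrt_le_iff.2 ⟨by positivity,
    by nlinarith [mul_nonneg hz he, mul_nonneg hz hp, mul_nonneg he hp]⟩

theorem norm_le_stateNorm : ‖z r‖ ≤ stateNorm z e p r :=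
  Real.le_sqrt_of_sq_le (by nlinarith [sq_nonneg ‖e r‖, sq_nonneg ‖p r‖])

theorem norm_size_le_stateNorm : ‖p r‖ ≤ stateNorm z e p r :=
  Real.le_sqrt_of_sq_le (by nlinarith [sq_nonneg ‖z r‖, sq_nonneg ‖e r‖])

theorem historyNorm_nonneg {τ : ℝ} : 0 ≤ historyNorm τ z e p r :=
  Real.sSup_nonneg (by rintro _ ⟨σ, _, rfl⟩; exact stateNorm_nonneg)

theorem IsCascadeSolution.stateNorm_le_historyNorm {Γ Δ Λ : Matrix (Fin n) (Fin n) ℝ}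
    {φ : Vec n → Vec n} {τ : ℝ} {ρ : ℕ → ℝ} {A : ℝ → Matrix (Fin n) (Fin n) ℝ}
    (h : IsCascadeSolution Γ Δ φ τ ρ A Λ z e p) {s : ℝ} (hs : s ∈ Icc (ρ 0 - 2 * τ) (ρ 0)) :
    stateNorm z e p s ≤ historyNorm τ z e p (ρ 0) :=
  le_csSup h.history_bdd
    ⟨s - ρ 0, ⟨by linarith [hs.1], by linarith [hs.2]⟩, by simp only [add_sub_cancel]⟩

end StateNorm

/-! ### From matrix inequalities to operators, and the main theorem. -/

theorem adjoint_act {n : ℕ} (A : Matrix (Fin n) (Fin n) ℝ) :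
    ContinuousLinearMap.adjoint (act A) = act A.transpose := by
  rw [← ContinuousLinearMap.star_eq_adjoint, ← map_star, Matrix.star_eq_conjTranspose,
    Matrix.conjTranspose_eq_transpose_of_trivial]

theorem IsLyapunovMatrix.adjoint_act {n : ℕ} {M Q : Matrix (Fin n) (Fin n) ℝ}
    (hQ : IsLyapunovMatrix M Q) : ContinuousLinearMap.adjoint (act Q) = act Q := by
  rw [_root_.adjoint_act, ← Matrix.conjTranspose_eq_transpose_of_trivial, hQ.1.isHermitian.eq]

theorem IsLyapunovMatrix.isLyapunovPair {n : ℕ} {Γ Δ Q : Matrix (Fin n) (Fin n) ℝ} {q a : ℝ}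
    (hQ : IsLyapunovMatrix (Γ + Δ) Q) (hq : inducedNorm Q ≤ q) (ha : 1 ≤ a)
    (hΓ : inducedNorm Γ ≤ a) (hΔ : inducedNorm Δ ≤ a) :
    IsLyapunovPair (act Γ) (act Δ) (act Q) q a where
  symm x y := by
    rw [← ContinuousLinearMap.adjoint_inner_left, hQ.adjoint_act]
  nonneg x := by
    rw [real_inner_comm, Matrix.inner_toEuclideanCLM]
    simpa using hQ.1.posSemidef.dotProduct_mulVec_nonneg x.ofLp
  decrease x := by
    have h1 : 0 ≤ inner ℝ x (act (-1 - ((Γ + Δ).transpose * Q + Q * (Γ + Δ))) x) := by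
      rw [Matrix.inner_toEuclideanCLM]
      simpa using hQ.2.dotProduct_mulVec_nonneg x.ofLp
    have h2 : act (-1 - ((Γ + Δ).transpose * Q + Q * (Γ + Δ))) x =
        -x - (ContinuousLinearMap.adjoint (act (Γ + Δ)) (act Q x) + act Q (act (Γ + Δ) x)) := by
      rw [_root_.adjoint_act]
      simp only [act, map_sub, map_neg, map_one, map_add, map_mul]
      rfl
    have h3 : inner ℝ x (act Q (act (Γ + Δ) x)) = inner ℝ (act Q x) (act (Γ + Δ) x) := by
      rw [← ContinuousLinearMap.adjoint_inner_left, hQ.adjoint_act]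
    rw [h2, inner_sub_right, inner_add_right, inner_neg_right,
      ContinuousLinearMap.adjoint_inner_right, h3, real_inner_self_eq_norm_sq,
      real_inner_comm] at h1
    have h4 : act Γ + act Δ = act (Γ + Δ) := (map_add _ _ _).symm
    rw [h4]
    linarith
  norm_P := hq
  norm_G := hΓ
  norm_D := hΔ
  one_le := ha

theorem lemma6 (n : ℕ) (Γ Δ Q : Matrix (Fin n) (Fin n) ℝ) (φ : Vec n → Vec n)
    (q a γ τ : ℝ) (Tm TM : ℝ) (ρ : ℕ → ℝ) (F : Fin n → ℝ) (Λ : Matrix (Fin n) (Fin n) ℝ)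
    (hQ : IsLyapunovMatrix (Γ + Δ) Q) (hq : inducedNorm Q ≤ q)
    (ha : 1 ≤ a) (hΓ : inducedNorm Γ ≤ a) (hΔ : inducedNorm Δ ≤ a)
    (hφ : ∀ x, ‖φ x‖ ≤ γ * ‖x‖)
    (hρ : IsJumpSequence Tm TM ρ) (hF : ∀ i, 0 ≤ F i) (hΛ : IsSizeUpdate F TM Λ)
    (hγ : γ ≤ 1 / (8 * q))
    (hτ0 : 0 ≤ τ) (hτ : τ ≤ 1 / (8 * a ^ 2 * (8 * a * q + 1) ^ 2)) :
    ∃ μ δ : ℝ, 0 < μ ∧ 0 < δ ∧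
      ∀ A : ℝ → Matrix (Fin n) (Fin n) ℝ, IsErrorCoefficient F (ρ 0) A →
      ∀ z e p : ℝ → Vec n, IsCascadeSolution Γ Δ φ τ ρ A Λ z e p →
        (∀ i, |e (ρ 0) i| ≤ p (ρ 0) i / 2) →
        ∀ r, ρ 0 ≤ r →
          stateNorm z e p r ≤
            μ * historyNorm τ z e p (ρ 0) * Real.exp (-δ * (r - ρ 0)) := by
  rcases Nat.eq_zero_or_pos n with rfl | hn
  -- Dimension zero is separate because `q > 0` needs a nonzero vector.
  · refine ⟨1, 1, one_pos, one_pos, fun A _ z e p _ _ r _ => ?_⟩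
    have h0 : ∀ v : Vec 0, ‖v‖ = 0 := fun v => by rw [Subsingleton.elim v 0, norm_zero]
    refine stateNorm_le.trans ?_
    rw [h0, h0, h0, add_zero, add_zero, one_mul]
    exact mul_nonneg historyNorm_nonneg (Real.exp_pos _).le
  have : NeZero n := ⟨hn.ne'⟩
  have hP := hQ.isLyapunovPair hq ha hΓ hΔ
  have hq0 := hP.q_pos
  obtain ⟨M, δ₀, hM, hδ₀, hsize⟩ := hρ.exists_norm_size_le hΛ.1
  -- The rate is limited by the decay of `p`, by the Lyapunov margin, and by `1`, which keeps the
  -- weight nearly constant over one delay.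
  set δ := min δ₀ (min (1 / (16 * q)) 1) with hδdef
  have hδ : 0 < δ := lt_min hδ₀ (lt_min (by positivity) one_pos)
  set μ := 363 * (a * q) ^ 2 * M + 2 * M with hμdef
  have hμ : 0 < μ := by positivity
  refine ⟨μ, δ, hμ, hδ, fun A hA z e p h h0 r hr => ?_⟩
  set H := historyNorm τ z e p (ρ 0) with hH
  have hH0 : 0 ≤ H := historyNorm_nonneg
  have hp0 : ‖p (ρ 0)‖ ≤ H :=
    norm_size_le_stateNorm.trans (h.stateNorm_le_historyNorm ⟨by linarith, le_rfl⟩)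
  have hp : ∀ s, ρ 0 ≤ s → ‖p s‖ * Real.exp (δ * (s - ρ 0)) ≤ M * H := fun s hs => by
    have h1 : Real.exp (δ * (s - ρ 0)) ≤ Real.exp (δ₀ * (s - ρ 0)) :=
      Real.exp_le_exp.2 (mul_le_mul_of_nonneg_right (min_le_left _ _) (sub_nonneg.2 hs))
    calc _ ≤ ‖p s‖ * Real.exp (δ₀ * (s - ρ 0)) := by gcongr
      _ ≤ M * ‖p (ρ 0)‖ := hsize Γ Δ φ τ A z e p h s hs
      _ ≤ M * H := by gcongr
  have he : ∀ s, ρ 0 ≤ s → ‖e s‖ * Real.exp (δ * (s - ρ 0)) ≤ M * H := fun s hs =>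
    (mul_le_mul_of_nonneg_right (h.norm_error_le hρ hF hΛ hA h0 hs) (Real.exp_pos _).le).trans
      (hp s hs)
  -- The barrier must be positive while `H` may vanish, so the estimate is proved for every `K > H`
  -- and then `K` tends to `H`.
  have hz : ∀ K, H < K →
      ‖z r‖ * Real.exp (δ * (r - ρ 0)) ≤ 363 * (a * q) ^ 2 * (M * K) := fun K hK => by
    have htraj : IsDelayedTrajectory (act Γ) (act Δ) φ γ τ δ M K ρ z e :=
      { cont := h.z_cont
        flow := h.z_flow
        growth := hφ
        history := fun s hs =>
          (norm_le_stateNorm.trans (h.stateNorm_le_historyNorm hs)).trans hK.le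
        input := fun s hs => (he s hs).trans (by gcongr)
        one_le := hM
        history_pos := hH0.trans_lt hK
        rate_pos := hδ
        rate_le_one := (min_le_right _ _).trans (min_le_right _ _)
        delay_nonneg := hτ0 }
    exact htraj.norm_le_exp hP hρ hγ hτ ((min_le_right _ _).trans (min_le_left _ _)) hr
  have hzH : ‖z r‖ * Real.exp (δ * (r - ρ 0)) ≤ 363 * (a * q) ^ 2 * (M * H) := by
    refine ge_of_tendsto (x := 𝓝[>] H) (f := fun K => 363 * (a * q) ^ 2 * (M * K)) ?_
      (eventually_mem_nhdsWithin.mono hz)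
    exact ((by fun_prop : Continuous fun K : ℝ => 363 * (a * q) ^ 2 * (M * K)).tendsto H).mono_left
      nhdsWithin_le_nhds
  have htotal : stateNorm z e p r * Real.exp (δ * (r - ρ 0)) ≤ μ * H := by
    calc _ ≤ (‖z r‖ + ‖e r‖ + ‖p r‖) * Real.exp (δ * (r - ρ 0)) := by
          gcongr; exact stateNorm_le
      _ ≤ μ * H := by
          rw [hμdef]
          linarith [he r hr, hp r hr]
  rw [neg_mul, Real.exp_neg, ← div_eq_mul_inv, le_div_iff₀ (Real.exp_pos _)]
  exact htotal
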